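/- Let $k$ be an algebraically closed field (of any characteristic). A \emph{basis set} in $r$ variables is a finite nonempty set $\beta$ of monomials in $x_1,\dots,x_r$ such that every monomial dividing a member of $\beta$ belongs to $\beta$. Put $n=|\beta|$, and let $I_\beta\subseteq k[x_1,\dots,x_r]$ be the ideal generated by the monomials not in $\beta$; it has colength $n$ and so defines a point $t_\beta$ of the Hilbert scheme $\mathbf{H}^n$ of $n$ points of $\mathbb{A}^r_k$. Let $U_\beta\subseteq\mathbf{H}^n$ be the affine open subscheme that parameterizes the ideals $I$ such that $\beta$ is a basis of the quotient $k[x_1,\dots,x_r]/I$. Its coordinate ring $R$ is the $k$-algebra generated by the elements $c^d_j$ ($x^d\notin\beta$, $x^j\in\beta$), subject to the relations $$c^{d+e_i}_{j_0}=\sum_{x^j\in\beta}c^d_j\,c^{j+e_i}_{j_0}\qquad(x^d\notin\beta,\ x^{j_0}\in\beta,\ 1\le i\le r),$$ where $e_i$ is the $i$-th unit vector and $c^b_{j}$ means $1$ if $b=j$ and $0$ if $b\ne j$, whenever $x^b\in\beta$. The maximal ideal $M\subseteq R$ of $t_\beta$ is generated by the $c^d_j$ with $x^d\notin\beta$. The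 basis set $\beta$ is called \emph{smooth} if the cotangent space $M/M^2$ of $\mathbf{H}^n$ at $t_\beta$ satisfies $\dim_k(M/M^2)=rn$; equivalently, if $t_\beta$ is a nonsingular point of $\mathbf{H}^n$. (1) If $\beta_0$ is a smooth basis set in the $r-1$ variables $x_1,\dots,x_{r-1}$ (where $r\ge 1$), then for every integer $w_r>0$ its thickening $$\beta=\{m\cdot x_r^s \mid m\in\beta_0,\ 0\le s<w_r\}$$ is a smooth basis set in the $r$ variables $x_1,\dots,x_r$. (2) For all positive integers $w_1,\dots,w_r$, the box $$\operatorname{Box}(w_1,\dots,w_r)=\{x_1^{d_1}\cdots x_r^{d_r}\mid 0\le d_i<w_i\text{ for }1\le i\le r\}$$ is a smooth basis set in $x_1,\dots,x_r$. -/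

import Mathlib

noncomputable section

namespace HilbertPoints

open MvPolynomial

/-! Monomials in `x_1, ..., x_r` are identified with their exponent vectors
`d : Fin r →₀ ℕ`; divisibility of monomials is then the order `≤`. -/

/-- A basis set: a finite nonempty set of monomials that contains every divisor of each of its
members. -/
def IsBasisSet {r : ℕ} (β : Finset (Fin r →₀ ℕ)) : Prop :=
  β.Nonempty ∧ ∀ m₁ ∈ β, ∀ m₂, m₂ ≤ m₁ → m₂ ∈ β

/-- The monomial ideal `I_β`, generated by the monomials that do not belong to `β`. -/
def monomialIdeal (k : Type*) [Field k] {r : ℕ} (β : Finset (Fin r →₀ ℕ)) :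
    Ideal (MvPolynomial (Fin r) k) :=
  Ideal.span {p | ∃ d, d ∉ β ∧ p = monomial d 1}

/-- Arrows: pairs `(d, j)` with tail `d ∉ β` and head `j ∈ β`. -/
abbrev Arrow {r : ℕ} (β : Finset (Fin r →₀ ℕ)) : Type :=
  {d : Fin r →₀ ℕ // d ∉ β} × {j : Fin r →₀ ℕ // j ∈ β}

/-- The symbol `C^d_j`: an indeterminate if `d ∉ β`, and the constant `δ_{d,j}` if `d ∈ β`. -/
def coeffPoly (k : Type*) [Field k] {r : ℕ} (β : Finset (Fin r →₀ ℕ)) (d : Fin r →₀ ℕ)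
    (j : {j : Fin r →₀ ℕ // j ∈ β}) : MvPolynomial (Arrow β) k :=
  if h : d ∈ β then (if d = j.1 then 1 else 0) else X (⟨d, h⟩, j)

/-- The relation `τ = C^{d'}_{j₀} - ∑_{j ∈ β} C^d_j C^{j'}_{j₀}`, where `d' = d + e_i` and
`j' = j + e_i`. -/
def relation (k : Type*) [Field k] {r : ℕ} (β : Finset (Fin r →₀ ℕ)) (d : Fin r →₀ ℕ) (i : Fin r)
    (j₀ : {j : Fin r →₀ ℕ // j ∈ β}) : MvPolynomial (Arrow β) k :=
  coeffPoly k β (d + Finsupp.single i 1) j₀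
    - ∑ j : {j : Fin r →₀ ℕ // j ∈ β},
        coeffPoly k β d j * coeffPoly k β (j.1 + Finsupp.single i 1) j₀

/-- The ideal generated by all the relations `τ` with `d ∉ β`. -/
def relationIdeal (k : Type*) [Field k] {r : ℕ} (β : Finset (Fin r →₀ ℕ)) :
    Ideal (MvPolynomial (Arrow β) k) :=
  Ideal.span {p | ∃ d, d ∉ β ∧ ∃ i j₀, p = relation k β d i j₀}

/-- The coordinate ring `R` of the affine open subscheme `U_β` of the Hilbert scheme of `n = |β|`
points of affine `r`-space, whose points are the ideals `I` such that `β` is a basis of `k[x]/I`.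
That `R` represents the functor of these ideals is proved in `coordRing_universal`. -/
abbrev CoordRing (k : Type*) [Field k] {r : ℕ} (β : Finset (Fin r →₀ ℕ)) : Type _ :=
  MvPolynomial (Arrow β) k ⧸ relationIdeal k β

/-- The coefficient function `c^d_j` in `R`. -/
def coeffFun (k : Type*) [Field k] {r : ℕ} (β : Finset (Fin r →₀ ℕ)) (d : Fin r →₀ ℕ)
    (j : {j : Fin r →₀ ℕ // j ∈ β}) : CoordRing k β :=
  Ideal.Quotient.mk (relationIdeal k β) (coeffPoly k β d j)

/-- The universal ideal in `R[x]`, generated by the polynomials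
`F_d = x^d - ∑_{j ∈ β} c^d_j x^j`. -/
def universalIdeal (k : Type*) [Field k] {r : ℕ} (β : Finset (Fin r →₀ ℕ)) :
    Ideal (MvPolynomial (Fin r) (CoordRing k β)) :=
  Ideal.span {p | ∃ d, p = monomial d 1
    - ∑ j : {j : Fin r →₀ ℕ // j ∈ β}, monomial j.1 (coeffFun k β d j)}

/-- The maximal ideal `M` of the point `t_β` (the point of the ideal `I_β`) in `R`, generated by
the functions `c^d_j` with `d ∉ β`. See `maximalIdeal_eq_ker`. -/
def maximalIdeal (k : Type*) [Field k] {r : ℕ} (β : Finset (Fin r →₀ ℕ)) :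
    Ideal (CoordRing k β) :=
  Ideal.span {c | ∃ d j, d ∉ β ∧ c = coeffFun k β d j}

/-- `β` is a smooth basis set: `β` is a basis set, and the cotangent space `M / M²` of the point
`t_β` of the Hilbert scheme has `k`-dimension `r n`, where `n = |β|` (the dimension of the
component of the Hilbert scheme that contains the reduced subschemes, on which `t_β` lies);
equivalently, `t_β` is a nonsingular point. -/
def IsSmoothBasisSet (k : Type*) [Field k] {r : ℕ} (β : Finset (Fin r →₀ ℕ)) : Prop :=
  IsBasisSet β ∧ Module.rank k (maximalIdeal k β).Cotangent = ((r * β.card : ℕ) : Cardinal)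

/-- The thickening `{m * x_{r+1}^s | m ∈ β₀, 0 ≤ s < w}` of `β₀` from `r` to `r + 1` variables. -/
def thickening {r : ℕ} (β₀ : Finset (Fin r →₀ ℕ)) (w : ℕ) : Finset (Fin (r + 1) →₀ ℕ) :=
  (β₀ ×ˢ Finset.range w).image fun p =>
    Finsupp.embDomain Fin.castSuccEmb p.1 + Finsupp.single (Fin.last r) p.2

/-- `Box(w_1, ..., w_r)`: the monomials `x^d` with `d_i < w_i` for all `i`. -/
def box {r : ℕ} (w : Fin r → ℕ) : Finset (Fin r →₀ ℕ) :=
  (Fintype.piFinset fun i => Finset.range (w i)).map Finsupp.equivFunOnFinite.symm.toEmbedding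

theorem mem_box {r : ℕ} (w : Fin r → ℕ) (d : Fin r →₀ ℕ) : d ∈ box w ↔ ∀ i, d i < w i := by
  unfold box
  constructor
  · intro h i
    obtain ⟨f, hf, rfl⟩ := Finset.mem_map.1 h
    exact Finset.mem_range.1 (Fintype.mem_piFinset.1 hf i)
  · intro h
    refine Finset.mem_map.2 ⟨fun i => d i, ?_, by ext i; rfl⟩
    exact Fintype.mem_piFinset.2 fun i => Finset.mem_range.2 (h i)

/-! ### Verification that `CoordRing`, `universalIdeal` and `maximalIdeal` are the right objects -/

/-- The ideal `J` of `A[x]` is such that the monomials in `β` are an `A`-basis of `A[x]/J`. -/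
def HasMonomialBasis {A : Type*} [CommRing A] {r : ℕ} (β : Finset (Fin r →₀ ℕ))
    (J : Ideal (MvPolynomial (Fin r) A)) : Prop :=
  ∃ b : Module.Basis {j : Fin r →₀ ℕ // j ∈ β} A (MvPolynomial (Fin r) A ⧸ J),
    ∀ j, b j = Ideal.Quotient.mk J (monomial j.1 1)

section Universal

variable {k : Type*} [Field k] {r : ℕ} {β : Finset (Fin r →₀ ℕ)}

theorem coeffFun_of_mem {d : Fin r →₀ ℕ} (h : d ∈ β) (j : {j : Fin r →₀ ℕ // j ∈ β}) :
    coeffFun k β d j = if d = j.1 then 1 else 0 := by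
  unfold coeffFun coeffPoly
  rw [dif_pos h]
  split_ifs <;> simp

theorem coeffFun_succ (d : Fin r →₀ ℕ) (i : Fin r) (j₀ : {j : Fin r →₀ ℕ // j ∈ β}) :
    coeffFun k β (d + Finsupp.single i 1) j₀
      = ∑ j, coeffFun k β d j * coeffFun k β (j.1 + Finsupp.single i 1) j₀ := by
  by_cases h : d ∈ β
  · rw [Finset.sum_eq_single ⟨d, h⟩]
    · simp [coeffFun_of_mem h]
    · intro j _ hj
      rw [coeffFun_of_mem h, if_neg, zero_mul]
      rintro rfl
      exact hj rfl
    · simp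
  · have : relation k β d i j₀ ∈ relationIdeal k β :=
      Ideal.subset_span ⟨d, h, i, j₀, rfl⟩
    have := Ideal.Quotient.eq_zero_iff_mem.2 this
    rw [relation, map_sub, sub_eq_zero, map_sum] at this
    simpa only [coeffFun, map_mul] using this

/-- For a hom `φ : R → A`, the linear map `A[x] → A^β` with `x^d ↦ (φ (c^d_j))_j`. -/
def normalForm {A : Type*} [CommRing A] [Algebra k A] (φ : CoordRing k β →ₐ[k] A) :
    MvPolynomial (Fin r) A →ₗ[A] ({j : Fin r →₀ ℕ // j ∈ β} → A) :=
  (basisMonomials (Fin r) A).constr A fun d j => φ (coeffFun k β d j)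

theorem normalForm_monomial {A : Type*} [CommRing A] [Algebra k A] (φ : CoordRing k β →ₐ[k] A)
    (d : Fin r →₀ ℕ) (a : A) :
    normalForm φ (monomial d a) = fun j => a * φ (coeffFun k β d j) := by
  have h1 : (monomial d a : MvPolynomial (Fin r) A) = a • basisMonomials (Fin r) A d := by
    simp [coe_basisMonomials, smul_monomial]
  rw [h1, map_smul, normalForm, Module.Basis.constr_basis]
  rfl

theorem normalForm_X_mul {A : Type*} [CommRing A] [Algebra k A] (φ : CoordRing k β →ₐ[k] A)
    (i : Fin r) (p : MvPolynomial (Fin r) A) (j₀ : {j : Fin r →₀ ℕ // j ∈ β}) :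
    normalForm φ (X i * p) j₀
      = ∑ j, normalForm φ p j * φ (coeffFun k β (j.1 + Finsupp.single i 1) j₀) := by
  induction p using MvPolynomial.induction_on' with
  | monomial d a =>
    rw [mul_comm, X, monomial_mul, mul_one, normalForm_monomial, normalForm_monomial]
    simp only [coeffFun_succ d, map_sum, map_mul, Finset.mul_sum, mul_assoc]
  | add p q hp hq =>
    rw [mul_add, map_add, map_add, Pi.add_apply, hp, hq, ← Finset.sum_add_distrib]
    simp [add_mul]

theorem normalForm_mul_eq_zero {A : Type*} [CommRing A] [Algebra k A] (φ : CoordRing k β →ₐ[k] A)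
    (q p : MvPolynomial (Fin r) A) (hp : normalForm φ p = 0) : normalForm φ (q * p) = 0 := by
  induction q using MvPolynomial.induction_on with
  | C a => rw [← smul_eq_C_mul, map_smul, hp, smul_zero]
  | add q q' h h' => rw [add_mul, map_add, h, h', add_zero]
  | mul_X q i h =>
    rw [mul_comm q, mul_assoc]
    funext j₀
    rw [normalForm_X_mul, h]
    simp

theorem normalForm_of_mem {A : Type*} [CommRing A] [Algebra k A] (φ : CoordRing k β →ₐ[k] A)
    (j : {j : Fin r →₀ ℕ // j ∈ β}) (a : A) :
    normalForm φ (monomial j.1 a) = Pi.single j a := by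
  rw [normalForm_monomial]
  funext j'
  rw [coeffFun_of_mem j.2]
  by_cases h : j = j'
  · subst h; simp
  · have h' : j.1 ≠ j'.1 := fun e => h (Subtype.ext e)
    simp [h', Pi.single_eq_of_ne' h]

/-- The fibre of the universal ideal over `φ : R → A`. -/
theorem mem_map_universalIdeal {A : Type*} [CommRing A] [Algebra k A] (φ : CoordRing k β →ₐ[k] A)
    (p : MvPolynomial (Fin r) A) :
    p ∈ (universalIdeal k β).map (MvPolynomial.map φ.toRingHom) ↔ normalForm φ p = 0 := by
  have key : ∀ d : Fin r →₀ ℕ, monomial d 1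
      - ∑ j : {j : Fin r →₀ ℕ // j ∈ β}, monomial j.1 (φ (coeffFun k β d j))
      ∈ (universalIdeal k β).map (MvPolynomial.map φ.toRingHom) := by
    intro d
    have := Ideal.mem_map_of_mem (MvPolynomial.map φ.toRingHom)
      (Ideal.subset_span ⟨d, rfl⟩ : _ ∈ universalIdeal k β)
    rw [map_sub, map_sum] at this
    simp only [map_monomial, map_one] at this
    exact this
  constructor
  · intro hp
    rw [universalIdeal, Ideal.map_span] at hp
    refine Submodule.span_induction ?_ (map_zero _) ?_ ?_ hp
    · rintro _ ⟨_, ⟨d, rfl⟩, rfl⟩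
      simp only [map_sub, map_sum, map_monomial, normalForm_of_mem]
      rw [map_one, normalForm_monomial]
      funext j₀
      simp [Finset.sum_apply, Pi.single_apply]
    · intro x y _ _ hx hy
      rw [map_add, hx, hy, add_zero]
    · intro a x _ hx
      exact normalForm_mul_eq_zero φ a x hx
  · intro hp
    have hred : ∀ q : MvPolynomial (Fin r) A,
        q - ∑ j : {j : Fin r →₀ ℕ // j ∈ β}, monomial j.1 (normalForm φ q j)
          ∈ (universalIdeal k β).map (MvPolynomial.map φ.toRingHom) := by
      intro q
      induction q using MvPolynomial.induction_on' with
      | monomial d a =>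
        have := Ideal.mul_mem_left _ (C a) (key d)
        rw [mul_sub, Finset.mul_sum] at this
        simpa [C_mul_monomial, normalForm_monomial] using this
      | add q q' h h' =>
        have := Ideal.add_mem _ h h'
        convert this using 1
        simp only [map_add, Pi.add_apply, Finset.sum_add_distrib]
        ring
    have := hred p
    rw [hp] at this
    simpa using this

theorem hasMonomialBasis_map {A : Type*} [CommRing A] [Algebra k A] (φ : CoordRing k β →ₐ[k] A) :
    HasMonomialBasis β ((universalIdeal k β).map (MvPolynomial.map φ.toRingHom)) := by
  set J := (universalIdeal k β).map (MvPolynomial.map φ.toRingHom) with hJ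
  have hker : LinearMap.ker (normalForm φ) = J.restrictScalars A := by
    ext p
    rw [LinearMap.mem_ker, Submodule.restrictScalars_mem, hJ, mem_map_universalIdeal]
  have hsurj : Function.Surjective (normalForm φ) := by
    intro v
    refine ⟨∑ j, monomial j.1 (v j), ?_⟩
    rw [map_sum]
    simp only [normalForm_of_mem]
    exact Finset.univ_sum_single v
  let e₁ := (normalForm φ).quotKerEquivOfSurjective hsurj
  let e₂ : (MvPolynomial (Fin r) A ⧸ J) ≃ₗ[A] (MvPolynomial (Fin r) A ⧸ LinearMap.ker (normalForm φ)) :=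
    (Submodule.Quotient.restrictScalarsEquiv A J).symm.trans
      (Submodule.quotEquivOfEq _ _ hker.symm)
  refine ⟨Module.Basis.ofEquivFun (e₂.trans e₁), fun j => ?_⟩
  rw [Module.Basis.coe_ofEquivFun]
  rw [LinearEquiv.symm_apply_eq]
  exact (normalForm_of_mem φ j 1).symm

/-- Universal property: `R` represents the functor that takes a `k`-algebra `A` to the set of the
ideals `J` of `A[x]` such that the monomials in `β` are an `A`-basis of `A[x]/J`. -/
theorem coordRing_universal (A : Type*) [CommRing A] [Algebra k A] :
    Set.BijOn (fun φ : CoordRing k β →ₐ[k] A =>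
        (universalIdeal k β).map (MvPolynomial.map φ.toRingHom))
      Set.univ {J | HasMonomialBasis β J} := by
  refine ⟨fun φ _ => hasMonomialBasis_map φ, ?_, ?_⟩
  · intro φ _ ψ _ h
    have h : (universalIdeal k β).map (MvPolynomial.map φ.toRingHom)
      = (universalIdeal k β).map (MvPolynomial.map ψ.toRingHom) := h
    have hc : ∀ d j, φ (coeffFun k β d j) = ψ (coeffFun k β d j) := by
      intro d j
      have h1 : (monomial d 1 - ∑ j : {j : Fin r →₀ ℕ // j ∈ β}, monomial j.1 (φ (coeffFun k β d j))
          : MvPolynomial (Fin r) A)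
          ∈ (universalIdeal k β).map (MvPolynomial.map φ.toRingHom) := by
        rw [mem_map_universalIdeal]
        simp only [map_sub, map_sum, normalForm_of_mem]
        rw [normalForm_monomial]
        funext j₀
        simp [Finset.sum_apply, Pi.single_apply]
      rw [h, mem_map_universalIdeal] at h1
      simp only [map_sub, map_sum, normalForm_of_mem] at h1
      rw [normalForm_monomial] at h1
      have := congrFun h1 j
      simp [Finset.sum_apply, Pi.single_apply] at this
      exact (sub_eq_zero.1 this).symm
    refine Ideal.Quotient.algHom_ext _ (MvPolynomial.algHom_ext fun a => ?_)
    have := hc a.1.1 a.2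
    rw [coeffFun, coeffPoly, dif_neg a.1.2] at this
    exact this
  · rintro J ⟨b, hb⟩
    let c : (Fin r →₀ ℕ) → {j : Fin r →₀ ℕ // j ∈ β} → A := fun d j =>
      b.repr (Ideal.Quotient.mk J (monomial d 1)) j
    have hc1 : ∀ d (h : d ∈ β) j, c d j = if d = j.1 then 1 else 0 := by
      intro d h j
      have : c d j = b.repr (b ⟨d, h⟩) j := by rw [hb]
      rw [this, Module.Basis.repr_self, Finsupp.single_apply]
      simp [Subtype.ext_iff]
    have hsum : ∀ d, Ideal.Quotient.mk J (monomial d 1)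
        = ∑ j, c d j • Ideal.Quotient.mk J (monomial j.1 (1 : A)) := by
      intro d
      conv_lhs => rw [← b.sum_repr (Ideal.Quotient.mk J (monomial d 1))]
      simp only [hb]
      rfl
    have hc2 : ∀ d i j₀, c (d + Finsupp.single i 1) j₀
        = ∑ j, c d j * c (j.1 + Finsupp.single i 1) j₀ := by
      intro d i j₀
      have hm : ∀ d : Fin r →₀ ℕ, Ideal.Quotient.mk J (monomial (d + Finsupp.single i 1) (1 : A))
          = Ideal.Quotient.mk J (X i) * Ideal.Quotient.mk J (monomial d 1) := by
        intro d
        rw [← map_mul, mul_comm, X, monomial_mul, one_mul]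
      have : Ideal.Quotient.mk J (monomial (d + Finsupp.single i 1) (1 : A))
          = ∑ j, c d j • Ideal.Quotient.mk J (monomial (j.1 + Finsupp.single i 1) (1 : A)) := by
        rw [hm, hsum d, Finset.mul_sum]
        refine Finset.sum_congr rfl fun j _ => ?_
        rw [hm, mul_smul_comm]
      have := congrArg (fun v => b.repr v j₀) this
      simpa [c, Finsupp.finsetSum_apply] using this
    let f : MvPolynomial (Arrow β) k →ₐ[k] A := aeval fun a => c a.1.1 a.2
    have hf : ∀ d j, f (coeffPoly k β d j) = c d j := by
      intro d j
      unfold coeffPoly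
      split_ifs with h h'
      · rw [map_one, hc1 d h, if_pos h']
      · rw [map_zero, hc1 d h, if_neg h']
      · simp [f]
    have hrel : ∀ a ∈ relationIdeal k β, f a = 0 := by
      intro a ha
      refine (Ideal.span_le (I := RingHom.ker f)).2 ?_ ha
      rintro _ ⟨d, _, i, j₀, rfl⟩
      change f _ = 0
      rw [relation, map_sub, map_sum]
      simp only [map_mul, hf]
      rw [hc2, sub_self]
    let φ : CoordRing k β →ₐ[k] A := Ideal.Quotient.liftₐ _ f hrel
    have hφ : ∀ d j, φ (coeffFun k β d j) = c d j := fun d j => hf d j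
    refine ⟨φ, trivial, ?_⟩
    ext p
    change p ∈ (universalIdeal k β).map (MvPolynomial.map φ.toRingHom) ↔ _
    rw [mem_map_universalIdeal, ← Ideal.Quotient.eq_zero_iff_mem]
    have hn : ∀ p, normalForm φ p = b.equivFun (Ideal.Quotient.mk J p) := by
      intro p
      induction p using MvPolynomial.induction_on' with
      | monomial d a =>
        have h1 : (monomial d a : MvPolynomial (Fin r) A) = a • monomial d 1 := by
          simp [smul_monomial]
        have h2 : Ideal.Quotient.mk J (a • monomial d (1 : A))
            = a • Ideal.Quotient.mk J (monomial d (1 : A)) := rfl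
        rw [normalForm_monomial, h1, h2, map_smul]
        funext j
        rw [hφ]
        rfl
      | add p q hp hq => rw [map_add, map_add, map_add, hp, hq]
    rw [hn, LinearEquiv.map_eq_zero_iff]

/-- If `β` is a basis set, then all the `c^d_j` with `d ∉ β` vanish at some `k`-point of `R`; the
ideal `M` is the kernel of that point, and the ideal of `k[x]` that corresponds to the point
is `I_β`. -/
theorem maximalIdeal_eq_ker (hβ : IsBasisSet β) :
    ∃ φ : CoordRing k β →ₐ[k] k, maximalIdeal k β = RingHom.ker φ ∧
      (universalIdeal k β).map (MvPolynomial.map φ.toRingHom) = monomialIdeal k β := by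
  let f : MvPolynomial (Arrow β) k →ₐ[k] k := aeval fun _ => 0
  have hf : ∀ d j, d ∉ β → f (coeffPoly k β d j) = 0 := by
    intro d j h
    rw [coeffPoly, dif_neg h]
    simp [f]
  have hrel : ∀ a ∈ relationIdeal k β, f a = 0 := by
    intro a ha
    refine (Ideal.span_le (I := RingHom.ker f)).2 ?_ ha
    rintro _ ⟨d, hd, i, j₀, rfl⟩
    change f _ = 0
    rw [relation, map_sub, map_sum, hf _ _ fun h => hd (hβ.2 _ h _ le_self_add)]
    simp [hf d _ hd]
  let φ : CoordRing k β →ₐ[k] k := Ideal.Quotient.liftₐ _ f hrel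
  have hφ : ∀ d j, d ∉ β → φ (coeffFun k β d j) = 0 := fun d j h => hf d j h
  have hle : maximalIdeal k β ≤ RingHom.ker φ := by
    refine Ideal.span_le.2 ?_
    rintro _ ⟨d, j, hd, rfl⟩
    exact hφ d j hd
  refine ⟨φ, le_antisymm hle ?_, ?_⟩
  · have hred : ∀ a : MvPolynomial (Arrow β) k,
        Ideal.Quotient.mk (relationIdeal k β) a
          - algebraMap k (CoordRing k β) (f a) ∈ maximalIdeal k β := by
      intro a
      induction a using MvPolynomial.induction_on with
      | C a =>
        have : f (C a) = a := by simp [f]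
        rw [this]
        have : Ideal.Quotient.mk (relationIdeal k β) (C a)
          = algebraMap k (CoordRing k β) a := rfl
        rw [this, sub_self]
        exact Ideal.zero_mem _
      | add p q hp hq =>
        have := Ideal.add_mem _ hp hq
        rw [map_add, map_add, map_add]
        convert this using 1
        ring
      | mul_X p a _ =>
        have h0 : f (X a) = 0 := by simp [f]
        rw [map_mul, map_mul, h0, mul_zero, map_zero, sub_zero]
        refine Ideal.mul_mem_left _ _ (Ideal.subset_span ⟨a.1.1, a.2, a.1.2, ?_⟩)
        rw [coeffFun, coeffPoly, dif_neg a.1.2]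
    intro x hx
    obtain ⟨a, rfl⟩ := Ideal.Quotient.mk_surjective x
    have h0 : f a = 0 := hx
    simpa [h0] using hred a
  · refine le_antisymm ?_ ?_
    · rw [universalIdeal, Ideal.map_span, Ideal.span_le]
      rintro _ ⟨_, ⟨d, rfl⟩, rfl⟩
      simp only [map_sub, map_sum, map_monomial]
      by_cases hd : d ∈ β
      · rw [Finset.sum_eq_single ⟨d, hd⟩]
        · simp [coeffFun_of_mem hd]
        · intro j _ hj
          rw [coeffFun_of_mem hd, if_neg, map_zero, monomial_zero]
          rintro rfl
          exact hj rfl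
        · simp
      · have : ∀ j, φ.toRingHom (coeffFun k β d j) = 0 := fun j => hφ d j hd
        simp only [this, monomial_zero, Finset.sum_const_zero, sub_zero, map_one]
        exact Ideal.subset_span ⟨d, hd, rfl⟩
    · refine Ideal.span_le.2 ?_
      rintro _ ⟨d, hd, rfl⟩
      rw [SetLike.mem_coe, mem_map_universalIdeal, normalForm_monomial]
      funext j
      simp [hφ d j hd]

end Universal

end HilbertPoints

end

/-!
A tangent vector at `t_β` is a homomorphism `I_β → k[x] / I_β`, that is, a function of the arrows
`(d, j)` that is invariant under translation. This description makes sense for a finite lower set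
`β` of any ordered monoid of exponents; write `T(β)` for the resulting space. On the product
`β × γ`, a tangent vector is determined by its values at the monomials `(d, 0)` and `(0, s)`, and
these may be prescribed independently, so that `T(β × γ) ≅ T(β)^γ × T(γ)^β`. For `γ = [0, w)` the
ideal is principal and `T(γ) ≅ k^γ`. A thickening is the product of `β₀` with `[0, w)`, hence
`dim T(β) = w dim T(β₀) + w |β₀|`, which is `r |β| = r w |β₀|` exactly if
`dim T(β₀) = (r - 1) |β₀|`. A box is an iterated thickening of the point.
-/

noncomputable section

namespace HilbertPoints

section LinearAlgebra

theorem rank_dual_eq_natCast_iff {K V : Type*} [Field K] [AddCommGroup V] [Module K V] {n : ℕ} :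
    Module.rank K (Module.Dual K V) = n ↔ Module.rank K V = n := by
  by_cases hV : Module.Finite K V
  · rw [Module.dual_rank_eq, Cardinal.lift_eq_nat_iff]
  · have hV' : ¬ Module.Finite K (Module.Dual K V) := (Module.finite_dual_iff K).not.2 hV
    rw [← Module.rank_lt_aleph0_iff] at hV hV'
    exact iff_of_false (fun h => hV' (h ▸ Cardinal.natCast_lt_aleph0))
      (fun h => hV (h ▸ Cardinal.natCast_lt_aleph0))

theorem natCast_mul_eq_natCast_iff {ρ : Cardinal} {w n : ℕ} (hw : w ≠ 0) :
    w * ρ = (w * n : ℕ) ↔ ρ = n := by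
  refine ⟨fun h => ?_, fun h => by rw [h, Nat.cast_mul]⟩
  have hle : ρ ≤ w * ρ := Cardinal.le_mul_left (Nat.cast_ne_zero.2 hw)
  obtain ⟨m, rfl⟩ := Cardinal.lt_aleph0.1 (hle.trans_lt (h ▸ Cardinal.natCast_lt_aleph0))
  rw [← Nat.cast_mul, Nat.cast_inj] at h
  rw [Nat.eq_of_mul_eq_mul_left (Nat.pos_of_ne_zero hw) h]

theorem span_toCotangent_image_eq_top {R A : Type*} [CommRing R] [CommRing A] [Algebra R A]
    {I : Ideal A} (hR : ∀ a : A, ∃ c : R, a - algebraMap R A c ∈ I) {s : Set I}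
    (hs : Submodule.span A s = ⊤) : Submodule.span R (I.toCotangent '' s) = ⊤ := by
  have hsurj : Function.Surjective (algebraMap R (A ⧸ I)) := fun x => by
    obtain ⟨a, rfl⟩ := Ideal.Quotient.mk_surjective x
    exact (hR a).imp fun c hc => (Ideal.Quotient.eq.2 hc).symm
  have hA : Submodule.span A (I.toCotangent '' s) = ⊤ := by
    rw [Submodule.span_image, hs, Submodule.map_top, I.toCotangent_range]
  have : IsScalarTower R (A ⧸ I) I.Cotangent := .of_algebraMap_smul fun r x => by
    rw [IsScalarTower.algebraMap_apply R A (A ⧸ I), algebraMap_smul, algebraMap_smul]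
  rw [← Submodule.restrictScalars_span A (A ⧸ I) Ideal.Quotient.mk_surjective,
    Submodule.restrictScalars_eq_top_iff] at hA
  rw [← Submodule.restrictScalars_span R (A ⧸ I) hsurj, hA, Submodule.restrictScalars_top]

/-- The functional on the cotangent space of an ideal `I` given by the `ε`-coordinate of a point
with values in the dual numbers that reduces to a point at which `I` vanishes. -/
def cotangentFunctional {R A : Type*} [CommRing R] [CommRing A] [Algebra R A] {I : Ideal A}
    (φ : A →ₐ[R] DualNumber R) (hφ : ∀ x ∈ I, (φ x).fst = 0) : I.Cotangent →ₗ[R] R :=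
  Ideal.Cotangent.lift
    (TrivSqZeroExt.sndHom R R ∘ₗ φ.toLinearMap ∘ₗ I.subtype.restrictScalars R)
    fun x y => by
      change (φ (x.1 * y.1)).snd = 0
      simp [hφ x.1 x.2, hφ y.1 y.2]

theorem cotangentFunctional_toCotangent {R A : Type*} [CommRing R] [CommRing A] [Algebra R A]
    {I : Ideal A} (φ : A →ₐ[R] DualNumber R) (hφ : ∀ x ∈ I, (φ x).fst = 0) (x : I) :
    cotangentFunctional φ hφ (I.toCotangent x) = (φ x).snd :=
  rfl

end LinearAlgebra

/-- `F` describes a homomorphism from the ideal `I` spanned by the complement of the lower set `β`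
in a monoid algebra `k[M]` to the quotient `k[M] / I`: the image of the monomial `d ∉ β` is
`∑ j, F d j • j`, and `F d = 0` for `d ∈ β` by convention. The last two fields say that the
homomorphism commutes with multiplication by every monomial `m`, the monomials outside `β` being
zero in the quotient. These homomorphisms are the tangent vectors at `I` of the Hilbert scheme. -/
structure IsTangentVector {k : Type*} [Zero k] {M : Type*} [Add M] [LE M] {β : Finset M}
    (F : M → {j : M // j ∈ β} → k) : Prop where
  eq_zero_of_mem : ∀ d ∈ β, F d = 0
  translate : ∀ d ∉ β, ∀ (m : M) (j j' : {j : M // j ∈ β}), j'.1 = j.1 + m →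
    F (d + m) j' = F d j
  eq_zero_of_not_le : ∀ d ∉ β, ∀ (m : M) (j : {j : M // j ∈ β}), ¬ m ≤ j.1 → F (d + m) j = 0

/-- The tangent space at the point of the Hilbert scheme given by the lower set `β`. -/
def tangentSpace (k : Type*) [Semiring k] {M : Type*} [Add M] [LE M] (β : Finset M) :
    Submodule k (M → {j : M // j ∈ β} → k) where
  carrier := {F | IsTangentVector F}
  zero_mem' := ⟨fun _ _ => rfl, fun _ _ _ _ _ _ => rfl, fun _ _ _ _ _ => rfl⟩
  add_mem' hF hG :=
    { eq_zero_of_mem := fun d hd => by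
        rw [Pi.add_apply, hF.eq_zero_of_mem d hd, hG.eq_zero_of_mem d hd, add_zero]
      translate := fun d hd m j j' h =>
        congrArg₂ (· + ·) (hF.translate d hd m j j' h) (hG.translate d hd m j j' h)
      eq_zero_of_not_le := fun d hd m j h => by
        rw [Pi.add_apply, Pi.add_apply, hF.eq_zero_of_not_le d hd m j h,
          hG.eq_zero_of_not_le d hd m j h, add_zero] }
  smul_mem' c F hF :=
    { eq_zero_of_mem := fun d hd => by rw [Pi.smul_apply, hF.eq_zero_of_mem d hd, smul_zero]
      translate := fun d hd m j j' h => congrArg (c • ·) (hF.translate d hd m j j' h)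
      eq_zero_of_not_le := fun d hd m j h => by
        rw [Pi.smul_apply, Pi.smul_apply, hF.eq_zero_of_not_le d hd m j h, smul_zero] }

section Transport

variable {k M N : Type*} [AddCommMonoid M] [PartialOrder M] [AddCommMonoid N] [PartialOrder N]
  {β : Finset M} {γ : Finset N}

theorem IsTangentVector.comp_orderAddMonoidIso [Zero k] {F : N → {j : N // j ∈ γ} → k}
    (hF : IsTangentVector F) (e : M ≃+o N) (he : ∀ d, d ∈ β ↔ e d ∈ γ) :
    IsTangentVector fun d (j : {j : M // j ∈ β}) => F (e d) ⟨e j.1, (he j.1).1 j.2⟩ where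
  eq_zero_of_mem d hd := funext fun _ => congrFun (hF.eq_zero_of_mem _ ((he d).1 hd)) _
  translate d hd m j j' h := by
    rw [map_add]
    exact hF.translate _ (mt (he d).2 hd) _ _ _ (by simp only [h, map_add])
  eq_zero_of_not_le d hd m j h := by
    rw [map_add]
    exact hF.eq_zero_of_not_le _ (mt (he d).2 hd) _ _ (mt (map_le_map_iff e).1 h)

/-- An isomorphism of ordered monoids that carries `β` to `γ` identifies their tangent spaces. -/
def tangentSpaceCongr (k : Type*) [Semiring k] (e : M ≃+o N) (he : ∀ d, d ∈ β ↔ e d ∈ γ) :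
    tangentSpace k γ ≃ₗ[k] tangentSpace k β where
  toFun F := ⟨_, F.2.comp_orderAddMonoidIso e he⟩
  invFun F := ⟨_, F.2.comp_orderAddMonoidIso e.symm (by simp [he])⟩
  map_add' _ _ := rfl
  map_smul' _ _ := rfl
  left_inv F := Subtype.ext (by ext d j; simp)
  right_inv F := Subtype.ext (by ext d j; simp)

end Transport

theorem IsTangentVector.add_eq_zero {k M : Type*} [Zero k] [AddCommMonoid M] [PartialOrder M]
    [CanonicallyOrderedAdd M] {β : Finset M} (hβ : IsLowerSet (β : Set M))
    {F : M → {j : M // j ∈ β} → k} (hF : IsTangentVector F) {d : M} (hd : d ∉ β) (h0 : F d = 0)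
    (m : M) : F (d + m) = 0 := by
  funext j
  by_cases hm : m ≤ j.1
  · obtain ⟨j₀, hj₀⟩ := exists_add_of_le hm
    rw [add_comm] at hj₀
    have hj₀β : j₀ ∈ β := hβ (hj₀ ▸ le_self_add) j.2
    rw [hF.translate d hd m ⟨j₀, hj₀β⟩ j hj₀, h0]
    rfl
  · exact hF.eq_zero_of_not_le d hd m j hm

section Product

variable {k : Type*} [Semiring k] {M N : Type*} [AddCommMonoid M] [PartialOrder M]
  [AddCommMonoid N] [PartialOrder N] {β : Finset M} {γ : Finset N}

/-- The tangent vectors of `β` obtained from one of `β ×ˢ γ` by evaluating at the monomials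
`(d, 0)` and taking the coefficients of the monomials `(j, u)` for a fixed `u ∈ γ`. -/
def restrictLeft (h0 : 0 ∈ γ) :
    tangentSpace k (β ×ˢ γ) →ₗ[k] ({u : N // u ∈ γ} → tangentSpace k β) where
  toFun F u :=
    { val := fun d j => F.1 (d, 0) ⟨(j.1, u.1), Finset.mk_mem_product j.2 u.2⟩
      property :=
        { eq_zero_of_mem := fun d hd => funext fun _ =>
            congrFun (F.2.eq_zero_of_mem (d, 0) (Finset.mk_mem_product hd h0)) _
          translate := fun d hd m j j' h => by
            have hjj' : (j'.1, u.1) = (j.1, u.1) + (m, 0) := by rw [h, Prod.mk_add_mk, add_zero]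
            rw [← F.2.translate (d, 0) (fun h' => hd (Finset.mem_product.1 h').1) (m, 0) _
              ⟨_, Finset.mk_mem_product j'.2 u.2⟩ hjj', Prod.mk_add_mk, add_zero]
          eq_zero_of_not_le := fun d hd m j h => by
            rw [← F.2.eq_zero_of_not_le (d, 0) (fun h' => hd (Finset.mem_product.1 h').1) (m, 0)
              ⟨(j.1, u.1), Finset.mk_mem_product j.2 u.2⟩ (fun h' => h h'.1), Prod.mk_add_mk,
              add_zero] } }
  map_add' _ _ := rfl
  map_smul' _ _ := rfl

open Classical in
/-- The tangent vector of `β ×ˢ γ` with given restrictions `f u` to the monomials `(d, 0)` that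
vanishes at the monomials `(0, s)`. -/
def extendLeft [Sub N] [OrderedSub N] [CanonicallyOrderedAdd N] [IsOrderedCancelAddMonoid N]
    (hγ : IsLowerSet (γ : Set N)) (f : {u : N // u ∈ γ} → tangentSpace k β) :
    tangentSpace k (β ×ˢ γ) where
  val d j :=
    if d.2 ≤ j.1.2 then
      (f ⟨j.1.2 - d.2, hγ tsub_le_self (Finset.mem_product.1 j.2).2⟩).1 d.1
        ⟨j.1.1, (Finset.mem_product.1 j.2).1⟩
    else 0
  property :=
    have fst_notMem {d : M × N} {t : N} (hd : d ∉ β ×ˢ γ) (ht : t ∈ γ) (hdt : d.2 ≤ t) :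
        d.1 ∉ β := fun h => hd (Finset.mem_product.2 ⟨h, hγ hdt ht⟩)
    { eq_zero_of_mem := fun d hd => funext fun j => by
        simp only [(f _).2.eq_zero_of_mem _ (Finset.mem_product.1 hd).1, Pi.zero_apply, ite_self]
      translate := by
        rintro d hd m ⟨j, hj⟩ ⟨_, hj'⟩ rfl
        simp only [Prod.fst_add, Prod.snd_add, add_le_add_iff_right, add_tsub_add_eq_tsub_right]
        refine if_ctx_congr Iff.rfl (fun hle => ?_) fun _ => rfl
        exact (f _).2.translate _ (fst_notMem hd (Finset.mem_product.1 hj).2 hle) _ _ _ rfl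
      eq_zero_of_not_le := by
        rintro d hd m ⟨j, hj⟩ hm
        refine ite_eq_right_iff.2 fun hle => ?_
        have hd' := fst_notMem hd (Finset.mem_product.1 hj).2 (le_self_add.trans hle)
        exact (f _).2.eq_zero_of_not_le _ hd' _ _
          fun h => hm ⟨h, (le_add_self.trans hle : m.2 ≤ j.2)⟩ }

/-- The symmetry between `β ×ˢ γ` and `γ ×ˢ β` on tangent vectors. -/
def tangentSpaceSwap (k : Type*) [Semiring k] (β : Finset M) (γ : Finset N) :
    tangentSpace k (β ×ˢ γ) ≃ₗ[k] tangentSpace k (γ ×ˢ β) :=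
  tangentSpaceCongr k { AddEquiv.prodComm with map_le_map_iff' := and_comm }
    fun d => Finset.mem_product.trans (and_comm.trans (Finset.mem_product (p := d.swap)).symm)

theorem eq_zero_of_restrictLeft_eq_zero [CanonicallyOrderedAdd M] [CanonicallyOrderedAdd N]
    (hβ : IsLowerSet (β : Set M)) (hγ : IsLowerSet (γ : Set N)) (hβ0 : 0 ∈ β) (hγ0 : 0 ∈ γ)
    {F : tangentSpace k (β ×ˢ γ)} (hl : restrictLeft hγ0 F = 0)
    (hr : restrictLeft hβ0 (tangentSpaceSwap k β γ F) = 0) : F = 0 := by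
  have hlower : IsLowerSet ((β ×ˢ γ : Finset (M × N)) : Set (M × N)) := by
    rw [Finset.coe_product]
    exact hβ.prod hγ
  have hleft (d : M) : F.1 (d, 0) = 0 := funext fun j =>
    congrFun (congrFun (congrArg Subtype.val
      (congrFun hl ⟨j.1.2, (Finset.mem_product.1 j.2).2⟩)) d) ⟨j.1.1, (Finset.mem_product.1 j.2).1⟩
  have hright (s : N) : F.1 (0, s) = 0 := funext fun j =>
    congrFun (congrFun (congrArg Subtype.val
      (congrFun hr ⟨j.1.1, (Finset.mem_product.1 j.2).1⟩)) s) ⟨j.1.2, (Finset.mem_product.1 j.2).2⟩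
  refine Subtype.ext (funext fun ⟨d, s⟩ => ?_)
  by_cases hd : d ∈ β
  · by_cases hs : s ∈ γ
    · exact F.2.eq_zero_of_mem _ (Finset.mk_mem_product hd hs)
    · have := F.2.add_eq_zero hlower (fun h => hs (Finset.mem_product.1 h).2) (hright s) (d, 0)
      rwa [Prod.mk_add_mk, zero_add, add_zero] at this
  · have := F.2.add_eq_zero hlower (fun h => hd (Finset.mem_product.1 h).1) (hleft d) (0, s)
    rwa [Prod.mk_add_mk, zero_add, add_zero] at this

theorem restrictLeft_extendLeft [Sub N] [OrderedSub N] [CanonicallyOrderedAdd N]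
    [IsOrderedCancelAddMonoid N] (hγ : IsLowerSet (γ : Set N)) (hγ0 : 0 ∈ γ)
    (f : {u : N // u ∈ γ} → tangentSpace k β) : restrictLeft hγ0 (extendLeft hγ f) = f := by
  refine funext fun u => Subtype.ext (funext fun d => funext fun j => ?_)
  refine (if_pos zero_le).trans ?_
  simp only [tsub_zero]

theorem restrictLeft_swap_extendLeft [Sub M] [OrderedSub M] [CanonicallyOrderedAdd M]
    [IsOrderedCancelAddMonoid M] (hβ : IsLowerSet (β : Set M)) (hγ0 : 0 ∈ γ)
    (g : {u : M // u ∈ β} → tangentSpace k γ) :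
    restrictLeft hγ0 (tangentSpaceSwap k γ β (extendLeft hβ g)) = 0 := by
  refine funext fun u => Subtype.ext (funext fun d => funext fun j => ?_)
  classical
  exact (ite_eq_right_iff (p := d ≤ j.1)).2 fun _ => congrFun ((g _).2.eq_zero_of_mem 0 hγ0) _

/-- The normal module of the sum of two ideals in separate sets of variables is the direct sum of
their normal modules, each extended to the tensor product of the two quotients. -/
def tangentSpaceProdEquiv (k : Type*) [Ring k] [Sub M] [OrderedSub M] [CanonicallyOrderedAdd M]
    [IsOrderedCancelAddMonoid M] [Sub N] [OrderedSub N] [CanonicallyOrderedAdd N]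
    [IsOrderedCancelAddMonoid N] (hβ : IsLowerSet (β : Set M)) (hγ : IsLowerSet (γ : Set N))
    (hβ0 : 0 ∈ β) (hγ0 : 0 ∈ γ) :
    tangentSpace k (β ×ˢ γ) ≃ₗ[k]
      ({u : N // u ∈ γ} → tangentSpace k β) × ({u : M // u ∈ β} → tangentSpace k γ) :=
  LinearEquiv.ofBijective
    ((restrictLeft hγ0).prod (restrictLeft hβ0 ∘ₗ (tangentSpaceSwap k β γ).toLinearMap)) <| by
    refine ⟨(injective_iff_map_eq_zero _).2 fun F hF =>
      eq_zero_of_restrictLeft_eq_zero hβ hγ hβ0 hγ0 (congrArg Prod.fst hF) (congrArg Prod.snd hF),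
      ?_⟩
    rintro ⟨f, g⟩
    refine ⟨extendLeft hγ f + tangentSpaceSwap k γ β (extendLeft hβ g), Prod.ext ?_ ?_⟩
    · change restrictLeft hγ0 _ = f
      rw [map_add, restrictLeft_extendLeft, restrictLeft_swap_extendLeft, add_zero]
    · change restrictLeft hβ0 (tangentSpaceSwap k β γ _) = g
      rw [map_add, map_add, restrictLeft_swap_extendLeft, zero_add]
      exact restrictLeft_extendLeft hβ hβ0 g

end Product

section Principal

variable {M : Type*} [AddCommMonoid M] [PartialOrder M] [Sub M] [OrderedSub M]
  [CanonicallyOrderedAdd M] [IsOrderedCancelAddMonoid M] {β : Finset M} {w : M}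

open Classical in
/-- The tangent vector with a given value `v` at the generator `w` of the principal ideal that
complements `β`. -/
def tangentVectorOfPrincipal {k : Type*} [Semiring k] (hw : ∀ d, d ∈ β ↔ ¬ w ≤ d)
    (v : {j : M // j ∈ β} → k) : tangentSpace k β where
  val d j :=
    if w ≤ d ∧ d - w ≤ j.1 then
      v ⟨j.1 - (d - w), (hw _).2 fun h => (hw _).1 j.2 (h.trans tsub_le_self)⟩
    else 0
  property :=
    { eq_zero_of_mem := fun d hd => funext fun _ => if_neg fun h => (hw d).1 hd h.1
      translate := by
        rintro d hd m ⟨j, hj⟩ ⟨_, hj'⟩ rfl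
        have hwd : w ≤ d := not_not.1 (mt (hw d).2 hd)
        simp only [hwd, hwd.trans le_self_add, true_and, ← tsub_add_eq_add_tsub hwd,
          add_le_add_iff_right, add_tsub_add_eq_tsub_right]
      eq_zero_of_not_le := fun d hd m j hm => if_neg fun h => hm <| by
        have hwd : w ≤ d := not_not.1 (mt (hw d).2 hd)
        rw [← tsub_add_eq_add_tsub hwd] at h
        exact le_add_self.trans h.2 }

/-- If `β` is the complement of a principal ideal, then a tangent vector is determined by its value
at the generator `w`, which is arbitrary. -/
def tangentSpaceEquivOfPrincipal (k : Type*) [Semiring k] (hw : ∀ d, d ∈ β ↔ ¬ w ≤ d) :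
    tangentSpace k β ≃ₗ[k] ({j : M // j ∈ β} → k) where
  toFun F := F.1 w
  invFun := tangentVectorOfPrincipal hw
  map_add' _ _ := rfl
  map_smul' _ _ := rfl
  left_inv F := Subtype.ext <| funext fun d => funext fun j => by
    by_cases hwd : w ≤ d
    · have hwβ : w ∉ β := fun h => (hw w).1 h le_rfl
      have hd : F.1 (w + (d - w)) j = F.1 d j := by rw [add_tsub_cancel_of_le hwd]
      simp only [tangentVectorOfPrincipal]
      split_ifs with h
      · exact (F.2.translate w hwβ _ _ j (tsub_add_cancel_of_le h.2).symm).symm.trans hd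
      · exact (F.2.eq_zero_of_not_le w hwβ _ j fun h' => h ⟨hwd, h'⟩).symm.trans hd
    · exact (if_neg fun h => hwd h.1).trans
        (congrFun (F.2.eq_zero_of_mem d ((hw d).2 hwd)) j).symm
  right_inv v := by
    ext j
    simp [tangentVectorOfPrincipal]

end Principal

section Cotangent

variable {k : Type*} [Field k] {r : ℕ} {β : Finset (Fin r →₀ ℕ)}

theorem IsBasisSet.isLowerSet (hβ : IsBasisSet β) : IsLowerSet (β : Set (Fin r →₀ ℕ)) :=
  fun _ _ hle hmem => hβ.2 _ hmem _ hle

theorem IsBasisSet.zero_mem (hβ : IsBasisSet β) : 0 ∈ β :=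
  hβ.1.elim fun _ h => hβ.isLowerSet zero_le h

theorem coeffFun_add (d m : Fin r →₀ ℕ) (j₀ : {j : Fin r →₀ ℕ // j ∈ β}) :
    coeffFun k β (d + m) j₀ = ∑ j, coeffFun k β d j * coeffFun k β (j.1 + m) j₀ := by
  have zero (d j₀) : coeffFun k β (d + 0) j₀ =
      ∑ j, coeffFun k β d j * coeffFun k β (j.1 + 0) j₀ := by
    simp [coeffFun_of_mem]
  have add {m m' : Fin r →₀ ℕ}
      (h : ∀ d j₀, coeffFun k β (d + m) j₀ = ∑ j, coeffFun k β d j * coeffFun k β (j.1 + m) j₀)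
      (h' : ∀ d j₀, coeffFun k β (d + m') j₀ = ∑ j, coeffFun k β d j * coeffFun k β (j.1 + m') j₀)
      (d j₀) : coeffFun k β (d + (m + m')) j₀ =
        ∑ j, coeffFun k β d j * coeffFun k β (j.1 + (m + m')) j₀ := by
    calc coeffFun k β (d + (m + m')) j₀
        = ∑ l, coeffFun k β (d + m) l * coeffFun k β (l.1 + m') j₀ := by rw [← add_assoc, h']
      _ = ∑ l, ∑ j, coeffFun k β d j * coeffFun k β (j.1 + m) l * coeffFun k β (l.1 + m') j₀ := by
        simp only [h d, Finset.sum_mul]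
      _ = ∑ j, ∑ l, coeffFun k β d j * coeffFun k β (j.1 + m) l * coeffFun k β (l.1 + m') j₀ :=
        Finset.sum_comm
      _ = ∑ j, coeffFun k β d j * coeffFun k β (j.1 + (m + m')) j₀ := by
        refine Finset.sum_congr rfl fun j _ => ?_
        rw [← add_assoc, h', Finset.mul_sum]
        simp only [mul_assoc]
  induction m using Finsupp.induction_linear generalizing d j₀ with
  | zero => exact zero d j₀
  | add m m' hm hm' => exact add hm hm' d j₀
  | single i n =>
    induction n generalizing d j₀ with
    | zero => simpa only [Finsupp.single_zero] using zero d j₀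
    | succ n ih =>
      rw [Finsupp.single_add]
      exact add ih (fun d => coeffFun_succ d i) d j₀

theorem coeffFun_sub_mem_maximalIdeal (d : Fin r →₀ ℕ) (j : {j : Fin r →₀ ℕ // j ∈ β}) :
    coeffFun k β d j - (if d = j.1 then 1 else 0) ∈ maximalIdeal k β := by
  by_cases hd : d ∈ β
  · rw [coeffFun_of_mem hd, sub_self]
    exact zero_mem _
  · rw [if_neg (ne_of_mem_of_not_mem j.2 hd).symm, sub_zero]
    exact Ideal.subset_span ⟨d, j, hd, rfl⟩

/-- The class of `c^d_j` in `M / M²`, its value at `t_β` being subtracted so that the class is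
defined for `d ∈ β` too. -/
def cotangentClass (k : Type*) [Field k] (d : Fin r →₀ ℕ) (j : {j : Fin r →₀ ℕ // j ∈ β}) :
    (maximalIdeal k β).Cotangent :=
  (maximalIdeal k β).toCotangent ⟨_, coeffFun_sub_mem_maximalIdeal d j⟩

theorem cotangentClass_of_mem {d : Fin r →₀ ℕ} (hd : d ∈ β) (j : {j : Fin r →₀ ℕ // j ∈ β}) :
    cotangentClass k d j = 0 := by
  have h0 : (⟨_, coeffFun_sub_mem_maximalIdeal d j⟩ : maximalIdeal k β) = 0 :=
    Subtype.ext (sub_eq_zero.2 (coeffFun_of_mem hd j))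
  rw [cotangentClass, h0, map_zero]

theorem cotangentClass_add (hβ : IsLowerSet (β : Set (Fin r →₀ ℕ))) {d : Fin r →₀ ℕ} (hd : d ∉ β)
    (m : Fin r →₀ ℕ) (j₀ : {j : Fin r →₀ ℕ // j ∈ β}) :
    cotangentClass k (d + m) j₀ = ∑ j, if j.1 + m = j₀.1 then cotangentClass k d j else 0 := by
  have hdm : d + m ∉ β := fun h => hd (hβ le_self_add h)
  have hne {e : Fin r →₀ ℕ} (he : e ∉ β) (j : {j : Fin r →₀ ℕ // j ∈ β}) : e ≠ j.1 :=
    (ne_of_mem_of_not_mem j.2 he).symm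
  simp only [cotangentClass, ← map_zero (maximalIdeal k β).toCotangent, ← apply_ite, ← map_sum]
  rw [Ideal.toCotangent_eq, pow_two, AddSubmonoidClass.coe_finsetSum]
  simp only [apply_ite, ZeroMemClass.coe_zero, hne hdm, hne hd, if_false, sub_zero]
  rw [coeffFun_add, ← Finset.sum_sub_distrib]
  refine sum_mem fun j _ => ?_
  rw [← mul_boole, ← mul_sub]
  exact Ideal.mul_mem_mul (Ideal.subset_span ⟨d, j, hd, rfl⟩) (coeffFun_sub_mem_maximalIdeal _ _)

theorem span_cotangentClass (hβ : IsBasisSet β) :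
    Submodule.span k (Set.range fun a : Arrow β => cotangentClass k a.1.1 a.2) = ⊤ := by
  obtain ⟨φ, hφ, -⟩ := maximalIdeal_eq_ker (k := k) hβ
  have hconst (a : CoordRing k β) : a - algebraMap k (CoordRing k β) (φ a) ∈ maximalIdeal k β := by
    rw [hφ, RingHom.mem_ker, map_sub]
    exact sub_eq_zero.2 (φ.commutes _).symm
  rw [eq_top_iff, ← span_toCotangent_image_eq_top (fun a => ⟨_, hconst a⟩)
    (Submodule.span_span_coe_preimage ..)]
  refine Submodule.span_mono ?_
  rintro _ ⟨⟨_, hc⟩, ⟨d, j, hd, rfl⟩, rfl⟩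
  refine ⟨(⟨d, hd⟩, j), congrArg (maximalIdeal k β).toCotangent (Subtype.ext ?_)⟩
  dsimp only
  rw [if_neg (ne_of_mem_of_not_mem j.2 hd).symm, sub_zero]

theorem isTangentVector_iff_sum (hβ : IsLowerSet (β : Set (Fin r →₀ ℕ)))
    {F : (Fin r →₀ ℕ) → {j : Fin r →₀ ℕ // j ∈ β} → k} :
    IsTangentVector F ↔ (∀ d ∈ β, F d = 0) ∧ ∀ d ∉ β, ∀ m j₀,
      F (d + m) j₀ = ∑ j, if j.1 + m = j₀.1 then F d j else 0 := by
  have sum_eq (d m) (j j₀ : {j : Fin r →₀ ℕ // j ∈ β}) (h : j₀.1 = j.1 + m) :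
      (∑ l, if l.1 + m = j₀.1 then F d l else 0) = F d j := by
    simp [h]
  have sum_eq_zero (d m) (j₀ : {j : Fin r →₀ ℕ // j ∈ β}) (h : ¬ m ≤ j₀.1) :
      (∑ l, if l.1 + m = j₀.1 then F d l else 0) = 0 :=
    Finset.sum_eq_zero fun l _ => if_neg fun e => h (le_add_self.trans_eq e)
  refine ⟨fun hF => ⟨hF.eq_zero_of_mem, fun d hd m j₀ => ?_⟩, fun ⟨hmem, hsum⟩ => ⟨hmem,
    fun d hd m j j' h => (hsum d hd m j').trans (sum_eq d m j j' h),
    fun d hd m j h => (hsum d hd m j).trans (sum_eq_zero d m j h)⟩⟩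
  by_cases hm : m ≤ j₀.1
  · let j : {j : Fin r →₀ ℕ // j ∈ β} := ⟨j₀.1 - m, hβ tsub_le_self j₀.2⟩
    have hj : j₀.1 = j.1 + m := (tsub_add_cancel_of_le hm).symm
    rw [hF.translate d hd m j j₀ hj, sum_eq d m j j₀ hj]
  · rw [hF.eq_zero_of_not_le d hd m j₀ hm, sum_eq_zero d m j₀ hm]

theorem exists_algHom_coeffFun_eq {A : Type*} [CommRing A] [Algebra k A]
    (c : (Fin r →₀ ℕ) → {j : Fin r →₀ ℕ // j ∈ β} → A)
    (hmem : ∀ d ∈ β, ∀ j, c d j = if d = j.1 then 1 else 0)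
    (hsucc : ∀ d ∉ β, ∀ i j₀, c (d + Finsupp.single i 1) j₀ =
      ∑ j, c d j * c (j.1 + Finsupp.single i 1) j₀) :
    ∃ φ : CoordRing k β →ₐ[k] A, ∀ d j, φ (coeffFun k β d j) = c d j := by
  let f : MvPolynomial (Arrow β) k →ₐ[k] A := MvPolynomial.aeval fun a => c a.1.1 a.2
  have hf (d j) : f (coeffPoly k β d j) = c d j := by
    rw [coeffPoly]
    split_ifs with hd hdj
    · rw [map_one, hmem d hd, if_pos hdj]
    · rw [map_zero, hmem d hd, if_neg hdj]
    · exact MvPolynomial.aeval_X _ _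
  have hle : relationIdeal k β ≤ RingHom.ker f := by
    refine Ideal.span_le.2 ?_
    rintro _ ⟨d, hd, i, j₀, rfl⟩
    simp only [SetLike.mem_coe, RingHom.mem_ker, relation, map_sub, map_sum, map_mul, hf,
      hsucc d hd, sub_self]
  exact ⟨Ideal.Quotient.liftₐ _ f hle, hf⟩

theorem exists_algHom_dualNumber (hβ : IsLowerSet (β : Set (Fin r →₀ ℕ)))
    {F : (Fin r →₀ ℕ) → {j : Fin r →₀ ℕ // j ∈ β} → k} (hF : IsTangentVector F) :
    ∃ φ : CoordRing k β →ₐ[k] DualNumber k, ∀ d j, φ (coeffFun k β d j) =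
      (if d = j.1 then 1 else 0) + TrivSqZeroExt.inr (F d j) := by
  obtain ⟨hmem, hsum⟩ := (isTangentVector_iff_sum hβ).1 hF
  refine exists_algHom_coeffFun_eq _ (fun d hd j => ?_) fun d hd i j₀ => ?_
  · simp [hmem d hd]
  · have hdi : d + Finsupp.single i 1 ∉ β := fun h => hd (hβ le_self_add h)
    have hne {e : Fin r →₀ ℕ} (he : e ∉ β) (j : {j : Fin r →₀ ℕ // j ∈ β}) : e ≠ j.1 :=
      (ne_of_mem_of_not_mem j.2 he).symm
    simp [hne hd, hne hdi, hsum d hd, mul_add, Finset.sum_smul, ite_smul]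

theorem exists_dual_cotangentClass_eq (hβ : IsLowerSet (β : Set (Fin r →₀ ℕ)))
    {F : (Fin r →₀ ℕ) → {j : Fin r →₀ ℕ // j ∈ β} → k} (hF : IsTangentVector F) :
    ∃ l : Module.Dual k (maximalIdeal k β).Cotangent, ∀ d j, l (cotangentClass k d j) = F d j := by
  obtain ⟨φ, hφ⟩ := exists_algHom_dualNumber hβ hF
  have hle : maximalIdeal k β ≤ RingHom.ker ((TrivSqZeroExt.fstHom k k k).comp φ) := by
    refine Ideal.span_le.2 ?_
    rintro _ ⟨d, j, hd, rfl⟩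
    simp [hφ, (ne_of_mem_of_not_mem j.2 hd).symm]
  have hfst : ∀ x ∈ maximalIdeal k β, (φ x).fst = 0 := fun _ hx => hle hx
  refine ⟨cotangentFunctional φ hfst, fun d j => ?_⟩
  rw [cotangentClass, cotangentFunctional_toCotangent, map_sub, hφ]
  simp [apply_ite]

/-- The tangent space is dual to the cotangent space: a functional on `M / M²` corresponds to its
values on the classes of the `c^d_j`. -/
def dualCotangentEquiv (k : Type*) [Field k] (hβ : IsBasisSet β) :
    Module.Dual k (maximalIdeal k β).Cotangent ≃ₗ[k] tangentSpace k β :=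
  LinearEquiv.ofBijective
    { toFun := fun l =>
        { val := fun d j => l (cotangentClass k d j)
          property := (isTangentVector_iff_sum hβ.isLowerSet).2
            ⟨fun d hd => funext fun j => by rw [cotangentClass_of_mem hd, map_zero, Pi.zero_apply],
            fun d hd m j₀ => by
              simp only [cotangentClass_add hβ.isLowerSet hd, map_sum, apply_ite l, map_zero]⟩ }
      map_add' := fun _ _ => rfl
      map_smul' := fun _ _ => rfl }
    ⟨fun l l' h => LinearMap.ext_on (span_cotangentClass hβ) fun _ ⟨a, ha⟩ =>
        ha ▸ congrFun (congrFun (congrArg Subtype.val h) a.1.1) a.2,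
      fun F => (exists_dual_cotangentClass_eq hβ.isLowerSet F.2).imp fun _ hl =>
        Subtype.ext (funext fun d => funext (hl d))⟩

theorem isSmoothBasisSet_iff_rank_tangentSpace (hβ : IsBasisSet β) :
    IsSmoothBasisSet k β ↔ Module.rank k (tangentSpace k β) = (r * β.card : ℕ) := by
  rw [IsSmoothBasisSet, and_iff_right hβ, ← rank_dual_eq_natCast_iff,
    (dualCotangentEquiv k hβ).rank_eq]

end Cotangent

section Thickening

variable {k : Type*} [Field k] {r : ℕ} {β₀ : Finset (Fin r →₀ ℕ)} {w : ℕ}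

/-- Exponent vectors of monomials in `r + 1` variables as pairs of an exponent vector in the first
`r` variables and an exponent of the last variable. -/
def exponentSnocIso (r : ℕ) : (Fin (r + 1) →₀ ℕ) ≃+o (Fin r →₀ ℕ) × ℕ where
  toFun e := (e.comapDomain Fin.castSucc (Fin.castSucc_injective r).injOn, e (Fin.last r))
  invFun p := Finsupp.embDomain Fin.castSuccEmb p.1 + Finsupp.single (Fin.last r) p.2
  left_inv e := by
    ext i
    refine Fin.lastCases ?_ (fun i => ?_) i
    · simp [Finsupp.embDomain_of_notMem_range]
    · simpa using (Finsupp.embDomain_apply_self Fin.castSuccEmb _ i).trans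
        (Finsupp.comapDomain_apply ..)
  right_inv p := by
    refine Prod.ext (Finsupp.ext fun i => ?_) ?_
    · simpa using Finsupp.embDomain_apply_self Fin.castSuccEmb p.1 i
    · simp [Finsupp.embDomain_of_notMem_range]
  map_add' _ _ := Prod.ext (Finsupp.ext fun _ => rfl) rfl
  map_le_map_iff' {e e'} := (Fin.forall_fin_succ' (P := fun i => e i ≤ e' i)).symm

theorem thickening_eq_map (β₀ : Finset (Fin r →₀ ℕ)) (w : ℕ) : thickening β₀ w =
    (β₀ ×ˢ Finset.range w).map (exponentSnocIso r).symm.toEquiv.toEmbedding :=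
  (Finset.map_eq_image (exponentSnocIso r).symm.toEquiv.toEmbedding _).symm

theorem mem_thickening {e : Fin (r + 1) →₀ ℕ} :
    e ∈ thickening β₀ w ↔ exponentSnocIso r e ∈ β₀ ×ˢ Finset.range w := by
  rw [thickening_eq_map, Finset.mem_map_equiv]
  rfl

theorem card_thickening (β₀ : Finset (Fin r →₀ ℕ)) (w : ℕ) :
    (thickening β₀ w).card = β₀.card * w := by
  rw [thickening_eq_map, Finset.card_map, Finset.card_product, Finset.card_range]

theorem isBasisSet_thickening_iff (hw : 0 < w) :
    IsBasisSet (thickening β₀ w) ↔ IsBasisSet β₀ := by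
  have hne : (thickening β₀ w).Nonempty ↔ β₀.Nonempty := by
    rw [thickening_eq_map, Finset.map_nonempty, Finset.nonempty_product,
      and_iff_left (Finset.nonempty_range_iff.2 hw.ne')]
  refine and_congr hne ⟨fun h d hd d' hle => ?_, fun h e he e' hle => ?_⟩
  · have hmem (d) : (exponentSnocIso r).symm (d, 0) ∈ thickening β₀ w ↔ d ∈ β₀ := by
      simp [mem_thickening, hw]
    exact (hmem d').1 (h _ ((hmem d).2 hd) _
      ((map_le_map_iff (exponentSnocIso r).symm).2 (Prod.mk_le_mk.2 ⟨hle, le_rfl⟩)))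
  · rw [mem_thickening, Finset.mem_product, Finset.mem_range] at he ⊢
    have hle' := (map_le_map_iff (exponentSnocIso r)).2 hle
    exact ⟨h _ he.1 _ hle'.1, hle'.2.trans_lt he.2⟩

/-- The decomposition of `tangentSpaceProdEquiv` for `β₀` and the interval `[0, w)` of exponents of
the last variable, whose complement is the principal ideal generated by `w`. -/
def tangentSpaceThickeningEquiv (k : Type*) [Field k] (hβ₀ : IsBasisSet β₀) (hw : 0 < w) :
    tangentSpace k (thickening β₀ w) ≃ₗ[k] ({u : ℕ // u ∈ Finset.range w} → tangentSpace k β₀) ×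
      ({j : Fin r →₀ ℕ // j ∈ β₀} → {u : ℕ // u ∈ Finset.range w} → k) :=
  have hrange : IsLowerSet (Finset.range w : Set ℕ) := by
    rw [Finset.coe_range]
    exact isLowerSet_Iio w
  (tangentSpaceCongr k (exponentSnocIso r) fun _ => mem_thickening).symm ≪≫ₗ
    tangentSpaceProdEquiv k hβ₀.isLowerSet hrange hβ₀.zero_mem (Finset.mem_range.2 hw) ≪≫ₗ
    (LinearEquiv.refl k _).prodCongr (LinearEquiv.piCongrRight fun _ =>
      tangentSpaceEquivOfPrincipal k fun _ => Finset.mem_range.trans not_le.symm)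

theorem rank_tangentSpace_thickening (k : Type*) [Field k] (hβ₀ : IsBasisSet β₀) (hw : 0 < w) :
    Module.rank k (tangentSpace k (thickening β₀ w)) =
      w * Module.rank k (tangentSpace k β₀) + (β₀.card * w : ℕ) := by
  rw [(tangentSpaceThickeningEquiv k hβ₀ hw).rank_eq, rank_prod', rank_fun_eq_lift_mul,
    rank_fun_eq_lift_mul, rank_fun']
  simp

theorem isSmoothBasisSet_thickening_iff (hw : 0 < w) :
    IsSmoothBasisSet k (thickening β₀ w) ↔ IsSmoothBasisSet k β₀ := by
  by_cases hβ₀ : IsBasisSet β₀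
  · rw [isSmoothBasisSet_iff_rank_tangentSpace hβ₀,
      isSmoothBasisSet_iff_rank_tangentSpace ((isBasisSet_thickening_iff hw).2 hβ₀),
      rank_tangentSpace_thickening k hβ₀ hw, card_thickening,
      add_one_mul, Nat.cast_add, Cardinal.add_nat_inj, ← mul_assoc, mul_comm (r * _) w,
      natCast_mul_eq_natCast_iff hw.ne']
  · exact iff_of_false (fun h => hβ₀ ((isBasisSet_thickening_iff hw).1 h.1)) fun h => hβ₀ h.1

end Thickening

section Box

theorem box_succ {r : ℕ} (w : Fin (r + 1) → ℕ) :
    box w = thickening (box fun i => w i.castSucc) (w (Fin.last r)) := by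
  ext e
  rw [mem_thickening, Finset.mem_product, Finset.mem_range, mem_box, mem_box, Fin.forall_fin_succ']
  rfl

theorem IsBasisSet.isSmoothBasisSet_of_fin_zero {k : Type*} [Field k] {β : Finset (Fin 0 →₀ ℕ)}
    (hβ : IsBasisSet β) : IsSmoothBasisSet k β := by
  have hmem (d : Fin 0 →₀ ℕ) : d ∈ β := Subsingleton.elim 0 d ▸ hβ.zero_mem
  have : Subsingleton (tangentSpace k β) := ⟨fun F G => Subtype.ext <| funext fun d =>
    (F.2.eq_zero_of_mem d (hmem d)).trans (G.2.eq_zero_of_mem d (hmem d)).symm⟩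
  rw [isSmoothBasisSet_iff_rank_tangentSpace hβ, rank_subsingleton', zero_mul, Nat.cast_zero]

theorem isSmoothBasisSet_box (k : Type*) [Field k] {r : ℕ} {w : Fin r → ℕ} (hw : ∀ i, 0 < w i) :
    IsSmoothBasisSet k (box w) := by
  induction r with
  | zero =>
    exact IsBasisSet.isSmoothBasisSet_of_fin_zero
      ⟨⟨0, (mem_box w 0).2 fun i => i.elim0⟩, fun _ _ m _ => (mem_box w m).2 fun i => i.elim0⟩
  | succ r ih =>
    rw [box_succ, isSmoothBasisSet_thickening_iff (hw _)]
    exact ih fun i => hw i.castSucc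

end Box

end HilbertPoints

end

theorem mainTheorem9_general (k : Type*) [Field k] :
    (∀ (r : ℕ) (β₀ : Finset (Fin r →₀ ℕ)) (w : ℕ), 0 < w →
      (HilbertPoints.IsSmoothBasisSet k (HilbertPoints.thickening β₀ w) ↔
        HilbertPoints.IsSmoothBasisSet k β₀)) ∧
    (∀ (r : ℕ) (w : Fin r → ℕ), (∀ i, 0 < w i) →
      HilbertPoints.IsSmoothBasisSet k (HilbertPoints.box w)) :=
  ⟨fun _ _ _ hw => HilbertPoints.isSmoothBasisSet_thickening_iff hw,
    fun _ _ hw => HilbertPoints.isSmoothBasisSet_box k hw⟩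

theorem mainTheorem9 (k : Type*) [Field k] [IsAlgClosed k] :
    (∀ (r : ℕ) (β₀ : Finset (Fin r →₀ ℕ)), HilbertPoints.IsSmoothBasisSet k β₀ →
      ∀ w : ℕ, 0 < w → HilbertPoints.IsSmoothBasisSet k (HilbertPoints.thickening β₀ w)) ∧
    (∀ (r : ℕ) (w : Fin r → ℕ), (∀ i, 0 < w i) →
      HilbertPoints.IsSmoothBasisSet k (HilbertPoints.box w)) := by
  obtain ⟨smooth_thickening_iff, smooth_box⟩ := mainTheorem9_general k
  exact ⟨fun r β₀ h w hw => (smooth_thickening_iff r β₀ w hw).2 h, smooth_box⟩
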